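/- Let $G$ be a profinite group and let $k$ be a field of characteristic $p$, where $p$ is a prime or $0$. A discrete $G$-module over $k$ is a $k$-linear representation $M$ of $G$ for which the action map $G\times M\to M$ is continuous when $M$ carries the discrete topology; these form a full subcategory ${}_G^d\mathrm{Vect}$ of the category of $k$-linear representations of $G$. The order $|H|$ of a profinite group $H$ is the supernatural number given by the least common multiple of the orders $|H/U|$, with $U$ ranging over the open normal subgroups of $H$; if $p=0$, the condition $p\nmid |H|$ is regarded as always satisfied. For an open normal subgroup $H$ of $G$, every $G/H$-module over $k$ (that is, every $k$-linear representation of $G/H$) is regarded as a discrete $G$-module through the quotient map $G\to G/H$. Then the following hold. (a) For every open normal subgroup $H$ of $G$ with $p\nmid |H|$, a $G/H$-module over $k$ is projective in the category of $G/H$-modules over $k$ if and only if it is projective in ${}_G^d\mathrm{Vect}$. (b) A discrete $G$-module over $k$ is projective in ${}_G^d\mathrm{Vect}$ if and only if it is isomorphic to a direct sum $\bigoplus_{i\in I}P_i$, for some index set $I$, in which each $P_i$ is a finite-dimensional indecomposable projective $G/H_i$-module over $k$ for some open normal subgroup $H_i$ of $G$ with $p\nmid |H_i|$ (the subgroup $H_i$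 may depend on $i$). -/

import Mathlib

open CategoryTheory

universe w u v

/-- Supernatural numbers: formal products `∏ q ^ n_q` over the primes `q`, with exponents
`n_q ∈ ℕ ∪ {∞}`. The order is the pointwise one, i.e. divisibility, so suprema are least common
multiples. -/
abbrev SupernaturalNumber : Type := Nat.Primes → ℕ∞

namespace SupernaturalNumber

/-- The supernatural number attached to a positive integer. -/
def ofNat (n : ℕ) : SupernaturalNumber := fun q => (padicValNat q.1 n : ℕ∞)

/-- `p` is a prime which divides the supernatural number `s`. In particular this is false for
`p = 0`: in characteristic zero every supernatural number is regarded as not divisible by the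
characteristic. -/
def PrimeDvd (p : ℕ) (s : SupernaturalNumber) : Prop :=
  ∃ hp : p.Prime, 1 ≤ s ⟨p, hp⟩

end SupernaturalNumber

/-- The order of a profinite group, as a supernatural number: the least common multiple of the
orders of its quotients by open normal subgroups. -/
noncomputable def profiniteOrder (G : Type v) [Group G] [TopologicalSpace G] :
    SupernaturalNumber :=
  ⨆ U : OpenNormalSubgroup G, SupernaturalNumber.ofNat (Nat.card (G ⧸ U.toSubgroup))

/-- A `k`-linear representation `M` of a topological group `G` is discrete if the action map
`G × M → M` is continuous, where `M` has the discrete topology. -/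
def IsDiscreteRep (k : Type u) (G : Type v) [Field k] [Group G] [TopologicalSpace G] :
    ObjectProperty (Rep.{w} k G) := fun M =>
  letI : TopologicalSpace M.V := ⊥
  Continuous fun x : G × M.V => M.ρ x.1 x.2

/-- The category of discrete `G`-modules over the field `k`: the full subcategory of the category
of `k`-linear representations of `G` on the discrete ones. -/
abbrev DiscreteRep (k : Type u) (G : Type v) [Field k] [Group G] [TopologicalSpace G] :=
  (IsDiscreteRep.{w} k G).FullSubcategory

section inflation

variable {k : Type u} {G : Type v} [Field k] [Group G] [TopologicalSpace G]

theorem isDiscreteRep_res [IsTopologicalGroup G] (H : OpenNormalSubgroup G)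
    (X : Rep.{w} k (G ⧸ H.toSubgroup)) :
    IsDiscreteRep k G (Rep.res (QuotientGroup.mk' H.toSubgroup) X) := by
  let : TopologicalSpace X.V := ⊥
  have : DiscreteTopology X.V := ⟨rfl⟩
  have : DiscreteTopology (G ⧸ H.toSubgroup) :=
    inferInstanceAs (DiscreteTopology (G ⧸ H.toOpenSubgroup.toSubgroup))
  have h : Continuous fun y : (G ⧸ H.toSubgroup) × X.V => X.ρ y.1 y.2 :=
    continuous_of_discreteTopology
  exact h.comp ((QuotientGroup.continuous_mk.comp continuous_fst).prodMk continuous_snd)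

/-- A `G/H`-module over `k`, for `H` an open normal subgroup of `G`, regarded as a discrete
`G`-module through the quotient map `G → G/H`. -/
def inflation [IsTopologicalGroup G] (H : OpenNormalSubgroup G)
    (X : Rep.{w} k (G ⧸ H.toSubgroup)) : DiscreteRep.{w} k G :=
  ⟨Rep.res (QuotientGroup.mk' H.toSubgroup) X, isDiscreteRep_res H X⟩

end inflation

/-! Everything rests on Higman's criterion: a representation of a finite group is projective iff the
identity is a trace `∑ g, g ∘ a ∘ g⁻¹`. Averaging with `a` turns `k`-linear lifts and `k`-linear
extensions into equivariant ones, so such representations are injective as well as projective.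

For (a), when the order of `H` is prime to the characteristic, averaging makes `H`-invariants exact
on discrete modules. A map out of a `G/H`-module lands in the `H`-invariants, so lifting problems
over `G` reduce to lifting problems over `G/H` (`HasTraceOne.isSmoothProjective`). Conversely,
Higman's test module is itself inflated from `G/H`.

For (b), let `M` be projective. Covering `M` by its finite-dimensional cyclic submodules and
splitting the cover shows that each vector is fixed by an endomorphism of finite rank
(`exists_finite_range`). Take a maximal independent family of finite-dimensional indecomposable
summands. Each is injective relative to finite-dimensional modules (`exists_extension`), so by a
Baer-type argument their sum has a complement. A nonzero complement would contain a further
indecomposable summand, obtained from a finite-rank idempotent; hence the sum is `M`. Finally, a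
nonzero projective with trivial `H`-action forces the order of `H` to be prime to the characteristic
(`card_ne_zero`): the trace over `G/W`, for small `W`, has the factor `|H/W|`. -/

namespace Representation

/-! ### Higman's criterion for finite groups -/

section FiniteGroup

variable {k Γ V W B : Type*} [Field k] [Group Γ] [AddCommGroup V] [Module k V]
  [AddCommGroup W] [Module k W] [AddCommGroup B] [Module k B]

/-- A representation of a finite group has trace one if the identity is the trace
`∑ g, g ∘ a ∘ g⁻¹` of some linear endomorphism `a`. By Higman's criterion this characterises
the projective representations. -/
def HasTraceOne [Fintype Γ] (σ : Representation k Γ V) : Prop :=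
  ∃ a : V →ₗ[k] V, ∀ x, ∑ g, σ g (a (σ g⁻¹ x)) = x

/-- The representation of `Γ` on functions `Γ → V` with `(g • φ) c = g • φ (g⁻¹ * c)`. -/
def funRep (σ : Representation k Γ V) : Representation k Γ (Γ → V) where
  toFun g := LinearMap.pi fun c => σ g ∘ₗ LinearMap.proj (g⁻¹ * c)
  map_one' := by ext; simp
  map_mul' g h := by
    refine LinearMap.ext fun φ => funext fun c => ?_
    simp [mul_assoc]

@[simp]
theorem funRep_apply (σ : Representation k Γ V) (g : Γ) (φ : Γ → V) (c : Γ) :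
    funRep σ g φ c = σ g (φ (g⁻¹ * c)) := rfl

/-- The equivariant map summing the values of a function. -/
def funRepSum [Fintype Γ] (σ : Representation k Γ V) : (funRep σ).IntertwiningMap σ where
  toLinearMap := ∑ c, LinearMap.proj c
  isIntertwining' g := by
    refine LinearMap.ext fun φ => ?_
    simp only [LinearMap.comp_apply, LinearMap.sum_apply, LinearMap.proj_apply, funRep_apply,
      map_sum]
    exact Fintype.sum_equiv (Equiv.mulLeft g⁻¹) _ _ fun c => rfl

theorem funRepSum_apply [Fintype Γ] (σ : Representation k Γ V) (φ : Γ → V) :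
    funRepSum σ φ = ∑ c, φ c := by
  change (∑ c, LinearMap.proj c : (Γ → V) →ₗ[k] V) φ = _
  simp

theorem funRepSum_surjective [Fintype Γ] (σ : Representation k Γ V) :
    Function.Surjective (funRepSum σ) := by
  classical
  intro x
  exact ⟨Pi.single 1 x, by rw [funRepSum_apply]; simp⟩

/-- Take `a` to be `s` followed by evaluation at `1`. Equivariance gives `g • a (g⁻¹ • x) = s x g`,
so the trace of `a` at `x` is the sum of the values of `s x`. -/
theorem hasTraceOne_of_section [Fintype Γ] (σ : Representation k Γ V)
    (s : σ.IntertwiningMap (funRep σ)) (hs : ∀ x, funRepSum σ (s x) = x) : σ.HasTraceOne := by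
  refine ⟨LinearMap.proj 1 ∘ₗ s.toLinearMap, fun x => ?_⟩
  conv_rhs => rw [← hs x, funRepSum_apply]
  refine Finset.sum_congr rfl fun g _ => ?_
  change σ g (s (σ g⁻¹ x) 1) = _
  rw [s.isIntertwining]
  simp

theorem isIntertwining_sum_conj [Fintype Γ] (σ : Representation k Γ V) (τ : Representation k Γ W)
    (f : V →ₗ[k] W) (h : Γ) (x : V) :
    ∑ g, τ g (f (σ g⁻¹ (σ h x))) = τ h (∑ g, τ g (f (σ g⁻¹ x))) := by
  rw [map_sum]
  refine Fintype.sum_equiv (Equiv.mulLeft h⁻¹) _ _ fun g => ?_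
  simp [← Module.End.mul_apply, ← map_mul]

/-- The equivariant map `∑ g, g ∘ f ∘ g⁻¹`. -/
def sumConj [Fintype Γ] (σ : Representation k Γ V) (τ : Representation k Γ W)
    (f : V →ₗ[k] W) : σ.IntertwiningMap τ where
  toLinearMap := ∑ g, τ g ∘ₗ f ∘ₗ σ g⁻¹
  isIntertwining' h := by
    refine LinearMap.ext fun x => ?_
    simpa using! isIntertwining_sum_conj σ τ f h x

theorem sumConj_apply [Fintype Γ] (σ : Representation k Γ V) (τ : Representation k Γ W)
    (f : V →ₗ[k] W) (x : V) : sumConj σ τ f x = ∑ g, τ g (f (σ g⁻¹ x)) := by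
  change (∑ g, τ g ∘ₗ f ∘ₗ σ g⁻¹) x = _
  simp

/-- For a `k`-linear lift `l` of `f`, the conjugates of `l ∘ a` sum to an equivariant lift: `q`
commutes with the sum and turns it into `f` of the trace of `a`. -/
theorem HasTraceOne.exists_lift [Fintype Γ] {σ : Representation k Γ V} (hσ : σ.HasTraceOne)
    {β : Representation k Γ B} {τ : Representation k Γ W} (q : β.IntertwiningMap τ)
    (hq : Function.Surjective q) (f : σ.IntertwiningMap τ) :
    ∃ F : σ.IntertwiningMap β, ∀ x, q (F x) = f x := by
  obtain ⟨a, ha⟩ := hσ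
  obtain ⟨l, hl⟩ := Module.projective_lifting_property q.toLinearMap f.toLinearMap hq
  refine ⟨sumConj σ β (l ∘ₗ a), fun x => ?_⟩
  have hl' : ∀ y, q (l y) = f y := fun y => LinearMap.congr_fun hl y
  rw [sumConj_apply, map_sum]
  conv_rhs => rw [← ha x, map_sum]
  refine Finset.sum_congr rfl fun g _ => ?_
  rw [q.isIntertwining, f.isIntertwining]
  exact congrArg _ (hl' _)

/-- Dual to lifting: with `l` a `k`-linear extension of `f`, the conjugates of `a ∘ l` are summed.
This is the injectivity of projectives used in the decomposition. -/
theorem HasTraceOne.exists_extension [Fintype Γ] {σ : Representation k Γ V} (hσ : σ.HasTraceOne)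
    (β : Representation k Γ B) (A : Submodule k B) (hA : ∀ g, ∀ x ∈ A, β g x ∈ A)
    (f : A →ₗ[k] V) (hf : ∀ g (x : A), f ⟨β g x, hA g x x.2⟩ = σ g (f x)) :
    ∃ F : β.IntertwiningMap σ, ∀ x : A, F x = f x := by
  obtain ⟨a, ha⟩ := hσ
  obtain ⟨l, hl⟩ := LinearMap.exists_extend f
  have hl' : ∀ y : A, l y = f y := fun y => LinearMap.congr_fun hl y
  refine ⟨sumConj β σ (a ∘ₗ l), fun x => ?_⟩
  rw [sumConj_apply]
  conv_rhs => rw [← ha (f x)]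
  refine Finset.sum_congr rfl fun g _ => ?_
  rw [← hf]
  exact congrArg (fun y => σ g (a y)) (hl' ⟨β g⁻¹ x, hA _ _ x.2⟩)

/-- If a normal subgroup of order divisible by the characteristic acts trivially on a
representation with trace one, then the representation vanishes. -/
theorem HasTraceOne.subsingleton [Fintype Γ] {σ : Representation k Γ V} (hσ : σ.HasTraceOne)
    (N : Subgroup Γ) [N.Normal] (hN : ∀ n ∈ N, σ n = 1) (hcard : (Nat.card N : k) = 0) :
    Subsingleton V := by
  classical
  obtain ⟨a, ha⟩ := hσ
  refine subsingleton_of_forall_eq 0 fun x => ?_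
  have : Fintype N := Fintype.ofFinite N
  have : Fintype (Γ ⧸ N) := Fintype.ofFinite _
  have h : ∀ g : Γ, σ g = σ (g : Γ ⧸ N).out := fun g => by
    obtain ⟨n, hn⟩ := QuotientGroup.mk_out_eq_mul N g
    rw [hn, map_mul, hN n n.2, mul_one]
  have h' : ∀ g : Γ, σ g⁻¹ = σ (g : Γ ⧸ N).out⁻¹ := fun g => by
    obtain ⟨n, hn⟩ := QuotientGroup.mk_out_eq_mul N g
    rw [hn, mul_inv_rev, map_mul, hN _ (N.inv_mem n.2), one_mul]
  -- The summand depends only on the coset of `g` modulo `N`, so each coset contributes `|N|` equal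
  -- terms, which add up to zero.
  rw [← ha x, Fintype.sum_equiv (Subgroup.groupEquivQuotientProdSubgroup (s := N)) _
    (fun c => σ c.1.out (a (σ c.1.out⁻¹ x))) ?_, Fintype.sum_prod_type]
  · simp only [Finset.sum_const, Finset.card_univ]
    refine Finset.sum_eq_zero fun c _ => ?_
    rw [← Nat.cast_smul_eq_nsmul k, ← Nat.card_eq_fintype_card, hcard, zero_smul]
  · intro g
    have hg : (Subgroup.groupEquivQuotientProdSubgroup (s := N) g).1 = (g : Γ ⧸ N) := by
      rfl
    rw [hg, ← h, ← h']

end FiniteGroup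

end Representation

section Finite

variable {k : Type u} {Γ : Type v} [Field k] [Group Γ]

theorem Rep.exists_lift_of_projective {X : Rep.{w} k Γ} [Projective X] {E F : Rep.{w} k Γ}
    (q : E.ρ.IntertwiningMap F.ρ) (hq : Function.Surjective q) (f : X.ρ.IntertwiningMap F.ρ) :
    ∃ g : X.ρ.IntertwiningMap E.ρ, ∀ x, q (g x) = f x := by
  let q' : E ⟶ F := Rep.ofHom q
  let f' : X ⟶ F := Rep.ofHom f
  have : Epi q' := (Rep.epi_iff_surjective q').2 hq
  refine ⟨(Projective.factorThru f' q').hom, fun x => ?_⟩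
  have h := congrArg (fun t => Rep.Hom.hom t x) (Projective.factorThru_comp f' q')
  exact h

theorem Rep.projective_of_hasTraceOne [Fintype Γ] {X : Rep.{w} k Γ} (h : X.ρ.HasTraceOne) :
    Projective X where
  factors {E F} f e he := by
    obtain ⟨g, hg⟩ := h.exists_lift e.hom ((Rep.epi_iff_surjective e).1 he) f.hom
    refine ⟨Rep.ofHom g, ?_⟩
    ext x
    exact hg x

/-- Projectivity splits the summation map; the universe `max v w` leaves room for the functions `Γ →
V`. -/
theorem Rep.hasTraceOne_of_projective [Fintype Γ] (X : Rep.{max v w} k Γ) [Projective X] :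
    X.ρ.HasTraceOne := by
  obtain ⟨s, hs⟩ := Rep.exists_lift_of_projective (X := X)
    (E := Rep.of (Representation.funRep X.ρ)) (F := X)
    (Representation.funRepSum X.ρ) (Representation.funRepSum_surjective X.ρ) (.id X.ρ)
  exact Representation.hasTraceOne_of_section X.ρ s hs

end Finite

/-! ### Smooth representations and their projectives -/

namespace Representation

section Smooth

variable {k : Type u} {G : Type v} [Field k] [Group G] [TopologicalSpace G]

/-- Every vector is fixed by an open normal subgroup. -/
def IsSmooth {V : Type*} [AddCommGroup V] [Module k V] (ρ : Representation k G V) : Prop :=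
  ∀ x, ∃ U : OpenNormalSubgroup G, ∀ g ∈ U, ρ g x = x

theorem IsSmooth.of_surjective {V W : Type*} [AddCommGroup V] [Module k V] [AddCommGroup W]
    [Module k W] {ρ : Representation k G V} {τ : Representation k G W} (h : ρ.IsSmooth)
    (q : ρ.IntertwiningMap τ) (hq : Function.Surjective q) : τ.IsSmooth := by
  intro y
  obtain ⟨x, rfl⟩ := hq y
  obtain ⟨U, hU⟩ := h x
  exact ⟨U, fun g hg => by rw [← q.isIntertwining, hU g hg]⟩

theorem isSmooth_comp_mk {V : Type*} [AddCommGroup V] [Module k V] (U : OpenNormalSubgroup G)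
    (σ : Representation k (G ⧸ U.toSubgroup) V) :
    IsSmooth (σ.comp (QuotientGroup.mk' U.toSubgroup)) := fun x => ⟨U, fun g hg => by
  have : (QuotientGroup.mk' U.toSubgroup) g = 1 := (QuotientGroup.eq_one_iff g).2 hg
  rw [MonoidHom.comp_apply, this, map_one, Module.End.one_apply]⟩

/-- Maps out of the representation lift along surjections of smooth representations. -/
def IsSmoothProjective {V : Type w} [AddCommGroup V] [Module k V] (ρ : Representation k G V) :
    Prop :=
  ∀ (E F : Type w) [AddCommGroup E] [Module k E] [AddCommGroup F] [Module k F]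
    (τ : Representation k G E) (τ' : Representation k G F), τ.IsSmooth →
    ∀ q : τ.IntertwiningMap τ', Function.Surjective q → ∀ f : ρ.IntertwiningMap τ',
    ∃ g : ρ.IntertwiningMap τ, ∀ x, q (g x) = f x

theorem IsSmoothProjective.of_retract {V W : Type w} [AddCommGroup V] [Module k V]
    [AddCommGroup W] [Module k W] {ρ : Representation k G V} {τ : Representation k G W}
    (h : ρ.IsSmoothProjective) (i : τ.IntertwiningMap ρ) (r : ρ.IntertwiningMap τ)
    (hri : ∀ x, r (i x) = x) : τ.IsSmoothProjective := by
  intro E F _ _ _ _ σ σ' hσ q hq f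
  obtain ⟨g, hg⟩ := h E F σ σ' hσ q hq (f.comp r)
  refine ⟨g.comp i, fun x => ?_⟩
  have := hg (i x)
  simpa [hri] using this

open DirectSum in
theorem IsSmoothProjective.directSum {ι : Type w} {V : ι → Type w} [∀ i, AddCommGroup (V i)]
    [∀ i, Module k (V i)] {ρ : ∀ i, Representation k G (V i)}
    (h : ∀ i, (ρ i).IsSmoothProjective) :
    (Representation.directSum ρ).IsSmoothProjective := by
  classical
  intro E F _ _ _ _ σ σ' hσ q hq f
  have key : ∀ i, ∃ g : (ρ i).IntertwiningMap σ, ∀ x, q (g x) = f (DirectSum.lof k ι V i x) := by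
    intro i
    refine h i E F σ σ' hσ q hq ⟨f.toLinearMap ∘ₗ DirectSum.lof k ι V i, fun g => ?_⟩
    refine LinearMap.ext fun x => ?_
    have := f.isIntertwining _ _ g (DirectSum.lof k ι V i x)
    simpa using this
  choose g hg using key
  refine ⟨⟨DirectSum.toModule k ι E fun i => (g i).toLinearMap, fun a => ?_⟩, fun x => ?_⟩
  · refine DirectSum.linearMap_ext k fun i => LinearMap.ext fun x => ?_
    have := (g i).isIntertwining _ _ a x
    simpa using this
  · have : q.toLinearMap ∘ₗ (DirectSum.toModule k ι E fun i => (g i).toLinearMap) =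
        f.toLinearMap := by
      refine DirectSum.linearMap_ext k fun i => LinearMap.ext fun x => ?_
      simpa using hg i x
    exact LinearMap.congr_fun this x

/-- The function representation over `G/H` inflates to a smooth representation of `G`, so the
summation map splits over `G`, and hence over `G/H`. -/
theorem IsSmoothProjective.hasTraceOne {V : Type (max u v w)} [AddCommGroup V] [Module k V]
    (H : OpenNormalSubgroup G) [Fintype (G ⧸ H.toSubgroup)]
    {σ : Representation k (G ⧸ H.toSubgroup) V}
    (h : IsSmoothProjective (σ.comp (QuotientGroup.mk' H.toSubgroup))) : σ.HasTraceOne := by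
  let q : IntertwiningMap ((funRep σ).comp (QuotientGroup.mk' H.toSubgroup))
      (σ.comp (QuotientGroup.mk' H.toSubgroup)) :=
    ⟨(funRepSum σ).toLinearMap, fun g => (funRepSum σ).isIntertwining' g⟩
  obtain ⟨s, hs⟩ := h _ _ _ _ (isSmooth_comp_mk H (funRep σ)) q (funRepSum_surjective σ) (.id _)
  refine hasTraceOne_of_section σ ⟨s.toLinearMap, fun g => ?_⟩ hs
  obtain ⟨g, rfl⟩ := QuotientGroup.mk_surjective g
  exact s.isIntertwining' g

end Smooth

end Representation

/-! ### Discrete modules as smooth representations -/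

section Discrete

variable {k : Type u} {G : Type v} [Field k] [Group G] [TopologicalSpace G]

theorem DiscreteRep.epi_of_surjective {M N : DiscreteRep.{w} k G} (f : M ⟶ N)
    (hf : Function.Surjective f.hom.hom) : Epi f where
  left_cancellation {Z} g h hgh := by
    ext y
    obtain ⟨x, rfl⟩ := hf y
    exact congrArg (fun t : M ⟶ Z => t.hom.hom x) hgh

theorem isDiscreteRep_of_isSmooth [IsTopologicalGroup G] {M : Rep.{w} k G} (h : M.ρ.IsSmooth) :
    IsDiscreteRep k G M := by
  let : TopologicalSpace M.V := ⊥
  have : DiscreteTopology M.V := ⟨rfl⟩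
  change Continuous fun x : G × M.V => M.ρ x.1 x.2
  refine continuous_iff_continuousAt.2 fun ⟨g, x⟩ => ?_
  obtain ⟨U, hU⟩ := h x
  refine (continuousAt_const (y := M.ρ g x)).congr ?_
  have h1 : ∀ᶠ y : G × M.V in nhds (g, x), g⁻¹ * y.1 ∈ U := by
    have hc : ContinuousAt (fun y : G × M.V => g⁻¹ * y.1) (g, x) := by fun_prop
    refine hc.eventually_mem (U.toOpenSubgroup.isOpen.mem_nhds ?_)
    simp
  have h2 : ∀ᶠ y : G × M.V in nhds (g, x), y.2 = x :=
    continuous_snd.continuousAt.eventually_mem ((isOpen_discrete {x}).mem_nhds (by simp))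
  filter_upwards [h1, h2] with y hy1 hy2
  rw [hy2]
  conv_lhs => rw [← hU _ hy1]
  rw [← Module.End.mul_apply, ← map_mul, mul_inv_cancel_left]

theorem IsDiscreteRep.isSmooth [IsTopologicalGroup G] [CompactSpace G]
    [TotallyDisconnectedSpace G] {M : Rep.{w} k G} (h : IsDiscreteRep k G M) :
    M.ρ.IsSmooth := by
  intro x
  let : TopologicalSpace M.V := ⊥
  have : DiscreteTopology M.V := ⟨rfl⟩
  replace h : Continuous fun x : G × M.V => M.ρ x.1 x.2 := h
  have hc : Continuous fun g : G => M.ρ g x := h.comp (continuous_id.prodMk continuous_const)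
  obtain ⟨U, hU⟩ := ProfiniteGrp.exist_openNormalSubgroup_sub_open_nhds_of_one
    ((isOpen_discrete {x}).preimage hc) (by simp)
  exact ⟨U, fun g hg => hU hg⟩

variable [IsTopologicalGroup G] [CompactSpace G] [TotallyDisconnectedSpace G]

/-- The quotient by the image is again discrete, and the quotient map agrees with zero after
precomposition with `f`. -/
theorem DiscreteRep.surjective_of_epi {M N : DiscreteRep.{w} k G} (f : M ⟶ N) [Epi f] :
    Function.Surjective f.hom.hom := by
  let R : Submodule k N.obj.V := LinearMap.range f.hom.hom.toLinearMap
  have hR : ∀ g, R ≤ R.comap (N.obj.ρ g) := by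
    rintro g _ ⟨x, rfl⟩
    exact ⟨M.obj.ρ g x, f.hom.hom.isIntertwining _ _ g x⟩
  let π : N.obj.ρ.IntertwiningMap (N.obj.ρ.quotient R hR) := ⟨R.mkQ, fun g => by ext; simp⟩
  have hs : (N.obj.ρ.quotient R hR).IsSmooth :=
    N.property.isSmooth.of_surjective π (Submodule.mkQ_surjective R)
  let Q : DiscreteRep.{w} k G := ⟨Rep.of (N.obj.ρ.quotient R hR), isDiscreteRep_of_isSmooth hs⟩
  let a : N ⟶ Q := ObjectProperty.homMk (Rep.ofHom π)
  let b : N ⟶ Q := ObjectProperty.homMk 0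
  have hab : a = b := by
    rw [← cancel_epi f]
    ext x
    exact (Submodule.Quotient.mk_eq_zero R).2 ⟨x, rfl⟩
  intro y
  have hy : π y = 0 := congrArg (fun t : N ⟶ Q => t.hom.hom y) hab
  exact (Submodule.Quotient.mk_eq_zero R).1 hy

theorem DiscreteRep.projective_iff (M : DiscreteRep.{w} k G) :
    Projective M ↔ M.obj.ρ.IsSmoothProjective := by
  constructor
  · intro hM E F _ _ _ _ τ τ' hτ q hq f
    let E' : DiscreteRep.{w} k G := ⟨Rep.of τ, isDiscreteRep_of_isSmooth hτ⟩
    let F' : DiscreteRep.{w} k G :=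
      ⟨Rep.of τ', isDiscreteRep_of_isSmooth (hτ.of_surjective q hq)⟩
    let q' : E' ⟶ F' := ObjectProperty.homMk (Rep.ofHom q)
    let f' : M ⟶ F' := ObjectProperty.homMk (Rep.ofHom f)
    have : Epi q' := DiscreteRep.epi_of_surjective q' hq
    refine ⟨(Projective.factorThru f' q').hom.hom, fun x => ?_⟩
    exact congrArg (fun t : M ⟶ F' => t.hom.hom x) (Projective.factorThru_comp f' q')
  · intro hM
    refine ⟨fun {E F} f e he => ?_⟩
    obtain ⟨g, hg⟩ := hM E.obj.V F.obj.V E.obj.ρ F.obj.ρ E.property.isSmooth e.hom.hom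
      (DiscreteRep.surjective_of_epi e) f.hom.hom
    refine ⟨ObjectProperty.homMk (Rep.ofHom g), ?_⟩
    ext x
    exact hg x

end Discrete

/-! ### Orders of open normal subgroups and inflation of projectives -/

section

variable {k : Type u} {G : Type v} [Field k] [Group G] [TopologicalSpace G]
  [IsTopologicalGroup G] [CompactSpace G]

instance OpenNormalSubgroup.finite_quotient (U : OpenNormalSubgroup G) :
    Finite (G ⧸ U.toSubgroup) :=
  Subgroup.quotient_finite_of_isOpen _ U.toOpenSubgroup.isOpen

instance OpenNormalSubgroup.compactSpace (H : OpenNormalSubgroup G) : CompactSpace H :=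
  isCompact_iff_compactSpace.1
    (H.toSubgroup.isClosed_of_isOpen H.toOpenSubgroup.isOpen).isCompact

instance OpenNormalSubgroup.isTopologicalGroup (H : OpenNormalSubgroup G) :
    IsTopologicalGroup H :=
  inferInstanceAs (IsTopologicalGroup H.toSubgroup)

/-- The intersection of an open normal subgroup of `G` with `H`. -/
def OpenNormalSubgroup.restrict (U H : OpenNormalSubgroup G) : OpenNormalSubgroup H where
  toSubgroup := U.toSubgroup.subgroupOf H.toSubgroup
  isOpen' := U.toOpenSubgroup.isOpen.preimage continuous_subtype_val
  isNormal' := Subgroup.Normal.subgroupOf inferInstance H.toSubgroup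

-- Vanishing in `k` treats all characteristics at once: for `p = 0` both sides fail, the quotients
-- being finite and nonempty.
variable (k) in
theorem primeDvd_profiniteOrder_iff (p : ℕ) [CharP k p] :
    SupernaturalNumber.PrimeDvd p (profiniteOrder G) ↔
      ∃ U : OpenNormalSubgroup G, (Nat.card (G ⧸ U.toSubgroup) : k) = 0 := by
  have hc : ∀ U : OpenNormalSubgroup G, Nat.card (G ⧸ U.toSubgroup) ≠ 0 := fun U =>
    Nat.card_pos.ne'
  constructor
  · rintro ⟨hp, h⟩
    let q : Nat.Primes := ⟨p, hp⟩
    replace h : 1 ≤ profiniteOrder G q := h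
    rw [profiniteOrder, iSup_apply, Order.one_le_iff_pos, lt_iSup_iff] at h
    obtain ⟨U, hU⟩ := h
    refine ⟨U, (CharP.cast_eq_zero_iff k p _).2 ?_⟩
    have : 0 < padicValNat p (Nat.card (G ⧸ U.toSubgroup)) := by
      simpa [SupernaturalNumber.ofNat] using! hU
    exact dvd_of_one_le_padicValNat this
  · rintro ⟨U, hU⟩
    have hdvd := (CharP.cast_eq_zero_iff k p _).1 hU
    have hp : p.Prime := by
      refine (CharP.char_is_prime_or_zero k p).resolve_right ?_
      rintro rfl
      exact hc U (zero_dvd_iff.1 hdvd)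
    refine ⟨hp, le_trans ?_ (le_iSup (fun U : OpenNormalSubgroup G =>
      SupernaturalNumber.ofNat (Nat.card (G ⧸ U.toSubgroup))) U ⟨p, hp⟩)⟩
    have : Fact p.Prime := ⟨hp⟩
    have := one_le_padicValNat_of_dvd (hc U) hdvd
    simpa [SupernaturalNumber.ofNat] using! this

namespace Representation

open scoped Classical in
theorem IsSmooth.exists_fixed_lift {E F : Type*} [AddCommGroup E] [Module k E] [AddCommGroup F]
    [Module k F] {τ : Representation k G E} {τ' : Representation k G F} (hτ : τ.IsSmooth)
    (q : τ.IntertwiningMap τ') (H : OpenNormalSubgroup G)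
    (hH : ∀ U : OpenNormalSubgroup H, (Nat.card (H ⧸ U.toSubgroup) : k) ≠ 0)
    (x : E) (hx : ∀ h ∈ H, τ' h (q x) = q x) : ∃ z, (∀ h ∈ H, τ h z = z) ∧ q z = q x := by
  obtain ⟨U, hU⟩ := hτ x
  let U' := U.restrict H
  have : Fintype (H ⧸ U'.toSubgroup) := Fintype.ofFinite _
  -- The `H`-orbit of `x`, parametrised by a finite quotient because `U ∩ H` fixes `x`. Its average
  -- is the invariant lift.
  let F : H ⧸ U'.toSubgroup → E := fun c => τ (c.out : H) x
  have hF : ∀ h : H, F h = τ h x := fun h => by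
    obtain ⟨n, hn⟩ := QuotientGroup.mk_out_eq_mul U'.toSubgroup h
    change τ ((Quotient.out (h : H ⧸ U'.toSubgroup) : H) : G) x = _
    rw [hn]
    change τ ((h : G) * (n : H)) x = _
    rw [map_mul, Module.End.mul_apply]
    exact congrArg (τ h) (hU _ n.2)
  have hF' : ∀ (h : H) c, τ h (F c) = F (h • c) := fun h c => by
    obtain ⟨c, rfl⟩ := QuotientGroup.mk_surjective c
    rw [hF]
    change _ = F ((h * c : H) : H ⧸ U'.toSubgroup)
    rw [hF, ← Module.End.mul_apply, ← map_mul]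
    rfl
  refine ⟨(Nat.card (H ⧸ U'.toSubgroup) : k)⁻¹ • ∑ c, F c, fun h hh => ?_, ?_⟩
  · rw [map_smul, map_sum]
    congr 1
    exact Fintype.sum_equiv (MulAction.toPerm (⟨h, hh⟩ : H)) _ _ fun c => hF' ⟨h, hh⟩ c
  · have : ∀ c, q (F c) = q x := fun c => by
      rw [q.isIntertwining]
      exact hx _ (c.out : H).2
    rw [map_smul, map_sum, Finset.sum_congr rfl fun c _ => this c, Finset.sum_const,
      Finset.card_univ, ← Nat.card_eq_fintype_card, ← Nat.cast_smul_eq_nsmul k, smul_smul,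
      inv_mul_cancel₀ (hH U'), one_smul]

/-- The image of `f` is fixed by `H`, and `q` stays surjective on `H`-invariants by averaging, so
the lift is found over the finite group `G/H`. -/
theorem HasTraceOne.isSmoothProjective {V : Type w} [AddCommGroup V] [Module k V]
    (H : OpenNormalSubgroup G)
    (hH : ∀ U : OpenNormalSubgroup H, (Nat.card (H ⧸ U.toSubgroup) : k) ≠ 0)
    [Fintype (G ⧸ H.toSubgroup)] {σ : Representation k (G ⧸ H.toSubgroup) V}
    (hσ : σ.HasTraceOne) :
    IsSmoothProjective (σ.comp (QuotientGroup.mk' H.toSubgroup)) := by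
  intro E F _ _ _ _ τ τ' hτ q hq f
  let q' : (τ.quotientToInvariants H.toSubgroup).IntertwiningMap
      (τ'.quotientToInvariants H.toSubgroup) :=
    ⟨q.toLinearMap.restrict fun x hx h => by
        change τ' _ (q x) = q x
        rw [← q.isIntertwining]
        exact congrArg q (hx h), fun g => by
      obtain ⟨g, rfl⟩ := QuotientGroup.mk_surjective g
      refine LinearMap.ext fun x => Subtype.ext ?_
      exact q.isIntertwining _ _ g x⟩
  have hq' : Function.Surjective q' := by
    rintro ⟨y, hy⟩
    obtain ⟨x, rfl⟩ := hq y
    obtain ⟨z, hz, hzx⟩ := hτ.exists_fixed_lift q H hH x fun h hh => hy ⟨h, hh⟩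
    exact ⟨⟨z, fun h => hz _ h.2⟩, Subtype.ext hzx⟩
  let f' : σ.IntertwiningMap (τ'.quotientToInvariants H.toSubgroup) :=
    ⟨f.toLinearMap.codRestrict _ fun x h => by
        change τ' h (f x) = f x
        rw [← f.isIntertwining]
        have : (QuotientGroup.mk' H.toSubgroup) (h : G) = 1 := (QuotientGroup.eq_one_iff _).2 h.2
        rw [MonoidHom.comp_apply, this, map_one, Module.End.one_apply], fun g => by
      obtain ⟨g, rfl⟩ := QuotientGroup.mk_surjective g
      refine LinearMap.ext fun x => Subtype.ext ?_
      exact f.isIntertwining _ _ g x⟩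
  obtain ⟨s, hs⟩ := hσ.exists_lift q' hq' f'
  refine ⟨⟨Submodule.subtype _ ∘ₗ s.toLinearMap, fun g => LinearMap.ext fun x => ?_⟩,
    fun x => congrArg Subtype.val (hs x)⟩
  exact congrArg Subtype.val (s.isIntertwining _ _ (g : G ⧸ H.toSubgroup) x)

/-- A nonzero smooth projective representation on which `H` acts trivially forces the order of
`H` to be prime to the characteristic. -/
theorem IsSmoothProjective.card_ne_zero [TotallyDisconnectedSpace G]
    {V : Type (max u v w)} [AddCommGroup V] [Module k V] [Nontrivial V]
    (H : OpenNormalSubgroup G) {σ : Representation k (G ⧸ H.toSubgroup) V}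
    (h : IsSmoothProjective (σ.comp (QuotientGroup.mk' H.toSubgroup)))
    (U : OpenNormalSubgroup H) : (Nat.card (H ⧸ U.toSubgroup) : k) ≠ 0 := by
  intro h0
  -- `U` is normal only in `H`; it is shrunk to a subgroup `W` normal in `G`.
  obtain ⟨W, hW⟩ := ProfiniteGrp.exist_openNormalSubgroup_sub_open_nhds_of_one
    (G := G) (U := (Subtype.val : H → G) '' (U : Set H))
    (H.toOpenSubgroup.isOpen.isOpenMap_subtype_val _ U.toOpenSubgroup.isOpen)
    ⟨1, U.one_mem, rfl⟩
  have hWH : W.toSubgroup ≤ H.toSubgroup := fun g hg => by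
    obtain ⟨x, -, rfl⟩ := hW hg
    exact x.2
  let π : G ⧸ W.toSubgroup →* G ⧸ H.toSubgroup :=
    QuotientGroup.map _ _ (MonoidHom.id G) hWH
  have : Fintype (G ⧸ W.toSubgroup) := Fintype.ofFinite _
  -- Inflating from `G/H` to `G/W` and then to `G` gives the original `G`-representation, so `h`
  -- also yields a trace over `G/W`.
  have ht : HasTraceOne (σ.comp π) :=
    IsSmoothProjective.hasTraceOne.{w} W (σ := (σ.comp π : Representation _ _ _)) h
  let N : Subgroup (G ⧸ W.toSubgroup) := H.toSubgroup.map (QuotientGroup.mk' W.toSubgroup)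
  have : N.Normal := Subgroup.Normal.map inferInstance _ (QuotientGroup.mk'_surjective _)
  refine not_subsingleton V (ht.subsingleton N ?_ ?_)
  · rintro _ ⟨n, hn, rfl⟩
    have : π (QuotientGroup.mk' W.toSubgroup n) = 1 := (QuotientGroup.eq_one_iff n).2 hn
    rw [MonoidHom.comp_apply, this, map_one]
  · have hN : Nat.card N = W.toSubgroup.relIndex H.toSubgroup := by
      rw [← Subgroup.relIndex_ker, QuotientGroup.ker_mk']
    have hdvd : Nat.card (H ⧸ U.toSubgroup) ∣ Nat.card N := by
      rw [hN]
      refine Subgroup.index_dvd_of_le (H := W.toSubgroup.subgroupOf H.toSubgroup) fun x hx => ?_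
      obtain ⟨y, hy, hyx⟩ := hW hx
      rwa [← Subtype.ext hyx]
    obtain ⟨c, hc⟩ := hdvd
    rw [hc, Nat.cast_mul, h0, zero_mul]

end Representation

theorem projective_iff_projective_inflation [TotallyDisconnectedSpace G]
    (H : OpenNormalSubgroup G)
    (hH : ∀ U : OpenNormalSubgroup H, (Nat.card (H ⧸ U.toSubgroup) : k) ≠ 0)
    (X : Rep.{max u v w} k (G ⧸ H.toSubgroup)) : Projective X ↔ Projective (inflation H X) := by
  have : Fintype (G ⧸ H.toSubgroup) := Fintype.ofFinite _
  rw [DiscreteRep.projective_iff]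
  exact ⟨fun _ => (Rep.hasTraceOne_of_projective.{max u w} X).isSmoothProjective H hH,
    fun h => Rep.projective_of_hasTraceOne
      (Representation.IsSmoothProjective.hasTraceOne.{w} H h)⟩

end

/-! ### Decomposing a module into finite-dimensional indecomposable summands -/

section ModuleTheory

open DirectSum

variable {R M : Type*} [Ring R] [AddCommGroup M] [Module R M]

/-- Maps from a finitely generated submodule into a direct sum extend as soon as maps into the
summands do. -/
theorem exists_extend_directSum_of_fg {ι : Type*} {P : ι → Type*} [∀ i, AddCommGroup (P i)]
    [∀ i, Module R (P i)] (A : Submodule R M) [Module.Finite R A] (B : Submodule R M) (hAB : A ≤ B)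
    (hext : ∀ i (f : A →ₗ[R] P i), ∃ g : B →ₗ[R] P i, ∀ a : A, g ⟨a, hAB a.2⟩ = f a)
    (f : A →ₗ[R] ⨁ i, P i) : ∃ g : B →ₗ[R] ⨁ i, P i, ∀ a : A, g ⟨a, hAB a.2⟩ = f a := by
  classical
  obtain ⟨s, hs⟩ := Module.Finite.fg_top (R := R) (M := A)
  -- The images of finitely many generators involve only finitely many summands, so only those
  -- coordinates need extending.
  let Y : Finset ι := s.biUnion fun a => DFinsupp.support (f a)
  have hY : ∀ i ∉ Y, DirectSum.component R ι P i ∘ₗ f = 0 := by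
    intro i hi
    refine LinearMap.ext_on hs fun a ha => ?_
    by_contra h
    exact hi (Finset.mem_biUnion.2 ⟨a, ha, DFinsupp.mem_support_iff.2 h⟩)
  choose g hg using fun i => hext i (DirectSum.component R ι P i ∘ₗ f)
  refine ⟨∑ i ∈ Y, DirectSum.lof R ι P i ∘ₗ g i, fun a => ?_⟩
  refine DirectSum.ext_component R fun j => ?_
  simp only [LinearMap.sum_apply, LinearMap.comp_apply, map_sum, hg]
  by_cases hj : j ∈ Y
  · rw [Finset.sum_eq_single_of_mem j hj]
    · rw [DirectSum.component.lof_self]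
    · intro i _ hij
      rw [DirectSum.component.of, dif_neg hij]
  · rw [Finset.sum_eq_zero]
    · exact (LinearMap.congr_fun (hY j hj) a).symm
    · intro i hi
      rw [DirectSum.component.of, dif_neg]
      rintro rfl
      exact hj hi

/-- A Baer-type criterion: extending maps from submodules of cyclic modules is enough. -/
theorem exists_extend_of_cyclic {Q : Type*} [AddCommGroup Q] [Module R Q]
    (hext : ∀ (x : M) (A : Submodule R M) (hA : A ≤ R ∙ x) (f : A →ₗ[R] Q),
      ∃ g : (R ∙ x) →ₗ[R] Q, ∀ a : A, g ⟨a, hA a.2⟩ = f a)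
    (N : Submodule R M) (f : N →ₗ[R] Q) : ∃ g : M →ₗ[R] Q, ∀ n : N, g n = f n := by
  obtain ⟨m, hm, hmax⟩ := zorn_le_nonempty₀ (Set.univ : Set (M →ₗ.[R] Q))
    (fun c _ hc y hy => ⟨LinearPMap.sSup c hc.directedOn, trivial,
      fun z hz => LinearPMap.le_sSup hc.directedOn hz⟩) ⟨N, f⟩ trivial
  have htop : ∀ x, x ∈ m.domain := by
    intro x
    -- Extending `m` from `m.domain ⊓ R ∙ x` to `R ∙ x` and gluing with `m` contradicts maximality
    -- unless `x` is already in the domain.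
    obtain ⟨g, hg⟩ := hext x (m.domain ⊓ R ∙ x) inf_le_right
      (m.toFun ∘ₗ Submodule.inclusion inf_le_left)
    have hagree : ∀ (a : m.domain) (b : (⟨R ∙ x, g⟩ : M →ₗ.[R] Q).domain), (a : M) = b →
        m a = (⟨R ∙ x, g⟩ : M →ₗ.[R] Q) b := by
      rintro ⟨a, ha⟩ ⟨b, hb⟩ (rfl : a = b)
      exact (hg ⟨a, ha, hb⟩).symm
    have h1 := hmax.2 trivial (m.left_le_sup _ hagree)
    exact h1.1 ((m.right_le_sup _ hagree).1 (Submodule.mem_span_singleton_self x))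
  refine ⟨m.toFun ∘ₗ LinearMap.id.codRestrict m.domain htop, fun n => ?_⟩
  exact (hm.2 (x := n) (y := ⟨n, htop n⟩) rfl).symm

section Algebra

variable {k : Type*} [Field k] [Algebra k R] [Module k M] [IsScalarTower k R M]

theorem Submodule.eq_of_le_of_finrank_le_of_tower {A B : Submodule R M} [Module.Finite k B]
    (h : A ≤ B) (h' : Module.finrank k B ≤ Module.finrank k A) : A = B := by
  have : FiniteDimensional k (B.restrictScalars k) := ‹Module.Finite k B›
  have := Submodule.eq_of_le_of_finrank_le (K := k) (S₁ := A.restrictScalars k)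
    (S₂ := B.restrictScalars k) h h'
  exact Submodule.restrictScalars_injective k R M this

theorem Submodule.finite_of_le_of_tower {A B : Submodule R M} [Module.Finite k B]
    (h : A ≤ B) : Module.Finite k A :=
  have : FiniteDimensional k (B.restrictScalars k) := ‹Module.Finite k B›
  Submodule.finiteDimensional_of_le (K := k) (S₁ := A.restrictScalars k)
    (S₂ := B.restrictScalars k) h

/-- A vector fixed by an endomorphism of finite rank lies in the image of an idempotent of
finite rank. -/
theorem exists_isIdempotentElem_of_finite_range (C : Submodule R M) (x : M) (φ : Module.End R M)
    (hφ : Module.Finite k (LinearMap.range φ)) (hC : LinearMap.range φ ≤ C) (hx : φ x = x) :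
    ∃ e : Module.End R M, IsIdempotentElem e ∧ Module.Finite k (LinearMap.range e) ∧
      LinearMap.range e ≤ C ∧ e x = x := by
  classical
  -- For `ψ` of minimal rank, `ψ * ψ` has the same range, so `ψ` is bijective on its range;
  -- composing `ψ` with the inverse of that bijection gives the idempotent.
  have hex : ∃ n, ∃ φ : Module.End R M, Module.Finite k (LinearMap.range φ) ∧
      LinearMap.range φ ≤ C ∧ φ x = x ∧ Module.finrank k (LinearMap.range φ) = n :=
    ⟨_, φ, hφ, hC, hx, rfl⟩
  obtain ⟨ψ, hψ, hψC, hψx, hn⟩ := Nat.find_spec hex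
  have hle : LinearMap.range (ψ * ψ) ≤ LinearMap.range ψ := LinearMap.range_comp_le_range ψ ψ
  have heq : LinearMap.range (ψ * ψ) = LinearMap.range ψ := by
    refine Submodule.eq_of_le_of_finrank_le_of_tower (k := k) hle ?_
    rw [hn]
    refine Nat.find_min' hex ⟨ψ * ψ, Submodule.finite_of_le_of_tower hle, hle.trans hψC, ?_, rfl⟩
    rw [Module.End.mul_apply, hψx, hψx]
  let r : LinearMap.range ψ →ₗ[R] LinearMap.range ψ :=
    ψ.rangeRestrict ∘ₗ (LinearMap.range ψ).subtype
  have hr : Function.Surjective r := by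
    rintro ⟨y, hy⟩
    rw [← heq] at hy
    obtain ⟨z, rfl⟩ := hy
    exact ⟨⟨ψ z, z, rfl⟩, rfl⟩
  have hr' : Function.Injective r := by
    have : FiniteDimensional k (LinearMap.range ψ) := hψ
    exact (LinearMap.injective_iff_surjective (f := r.restrictScalars k)).2 hr
  let E := LinearEquiv.ofBijective r ⟨hr', hr⟩
  let e : Module.End R M :=
    (LinearMap.range ψ).subtype ∘ₗ E.symm.toLinearMap ∘ₗ ψ.rangeRestrict
  have he : ∀ y ∈ LinearMap.range ψ, e y = y := fun y hy => by
    have : ψ.rangeRestrict y = E ⟨y, hy⟩ := rfl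
    change ((E.symm (ψ.rangeRestrict y) : LinearMap.range ψ) : M) = y
    rw [this, E.symm_apply_apply]
  have hre : LinearMap.range e ≤ LinearMap.range ψ := by
    rintro _ ⟨y, rfl⟩
    exact (E.symm (ψ.rangeRestrict y)).2
  exact ⟨e, LinearMap.ext fun y => he _ (hre ⟨y, rfl⟩), Submodule.finite_of_le_of_tower hre,
    hre.trans hψC, he x ⟨x, hψx⟩⟩

/-- Among the nonzero idempotents of finite rank with image in `C` there is one whose image has
only trivial idempotent endomorphisms. -/
theorem exists_isIdempotentElem_indecomposable (C : Submodule R M) (e : Module.End R M)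
    (he : IsIdempotentElem e) (he0 : e ≠ 0) (hfin : Module.Finite k (LinearMap.range e))
    (hC : LinearMap.range e ≤ C) :
    ∃ e : Module.End R M, IsIdempotentElem e ∧ e ≠ 0 ∧ Module.Finite k (LinearMap.range e) ∧
      LinearMap.range e ≤ C ∧
      ∀ t : Module.End R (LinearMap.range e), IsIdempotentElem t → t = 0 ∨ t = 1 := by
  classical
  have hex : ∃ n, ∃ e : Module.End R M, IsIdempotentElem e ∧ e ≠ 0 ∧
      Module.Finite k (LinearMap.range e) ∧ LinearMap.range e ≤ C ∧
      Module.finrank k (LinearMap.range e) = n := ⟨_, e, he, he0, hfin, hC, rfl⟩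
  obtain ⟨q, hq, hq0, hqf, hqC, hn⟩ := Nat.find_spec hex
  refine ⟨q, hq, hq0, hqf, hqC, fun t ht => or_iff_not_imp_left.2 fun ht0 => ?_⟩
  have hqq : ∀ y : LinearMap.range q, q.rangeRestrict (y : M) = y := by
    rintro ⟨_, y, rfl⟩
    exact Subtype.ext (LinearMap.congr_fun hq y)
  -- A nonzero idempotent `t` on the range extends to the idempotent `s` of `M`; minimality of rank
  -- makes `t` surjective, hence the identity.
  let s : Module.End R M := (LinearMap.range q).subtype ∘ₗ t ∘ₗ q.rangeRestrict
  have hst : ∀ y, s y = t (q.rangeRestrict y) := fun y => rfl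
  have hs : IsIdempotentElem s := LinearMap.ext fun y => by
    rw [Module.End.mul_apply, hst, hst, hqq, ← Module.End.mul_apply, ht]
  have hs0 : s ≠ 0 := by
    intro h
    refine ht0 (LinearMap.ext fun y => Subtype.ext ?_)
    have := LinearMap.congr_fun h (y : M)
    rwa [hst, hqq] at this
  have hle : LinearMap.range s ≤ LinearMap.range q := by
    rintro _ ⟨y, rfl⟩
    exact (t _).2
  have heq := Submodule.eq_of_le_of_finrank_le_of_tower (k := k) hle
    (hn.le.trans (Nat.find_min' hex
      ⟨s, hs, hs0, Submodule.finite_of_le_of_tower hle, hle.trans hqC, rfl⟩))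
  refine LinearMap.ext fun y => Subtype.ext ?_
  have hy : (y : M) ∈ LinearMap.range s := by rw [heq]; exact y.2
  obtain ⟨z, hz⟩ := hy
  have := LinearMap.congr_fun hs z
  rw [Module.End.mul_apply, hz, hst, hqq] at this
  simpa using this

end Algebra

theorem sSupIndep.insert_of_disjoint {α : Type*} [CompleteLattice α] [IsModularLattice α]
    {S : Set α} (hS : sSupIndep S) {a : α} (ha : Disjoint a (sSup S)) :
    sSupIndep (insert a S) := by
  rintro b (rfl | hb)
  · refine ha.mono_right (sSup_le_sSup ?_)
    rintro c ⟨rfl | hc, hne⟩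
    · exact absurd rfl hne
    · exact hc
  · have h1 : Disjoint b (sSup (S \ {b})) := hS hb
    have h2 : Disjoint (b ⊔ sSup (S \ {b})) a :=
      (ha.mono_right (sup_le (le_sSup hb) (sSup_le_sSup Set.sdiff_subset))).symm
    refine (h1.disjoint_sup_right_of_disjoint_sup_left h2).mono_right (sSup_le ?_)
    rintro c ⟨rfl | hc, hne⟩
    · exact le_sup_right
    · exact (le_sSup (Set.mem_sdiff_of_mem hc hne)).trans le_sup_left

section Decomposition

variable (k : Type*) [Field k] [Algebra k R] [Module k M] [IsScalarTower k R M]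

/-- A nonzero finite-dimensional direct summand with only trivial idempotent endomorphisms. -/
structure Submodule.IsIndecomposableSummand (Q : Submodule R M) : Prop where
  ne_bot : Q ≠ ⊥
  finite : Module.Finite k Q
  exists_projection : ∃ π : M →ₗ[R] Q, ∀ x : Q, π x = x
  idempotent : ∀ t : Module.End R Q, IsIdempotentElem t → t = 0 ∨ t = 1

/-- Zorn's lemma on independent families: `hext` splits off the sum of a maximal family, and `hloc`
would yield one more summand inside a nonzero complement. -/
theorem exists_iSupIndep_isIndecomposableSummand
    (hcyc : ∀ x : M, Module.Finite k (R ∙ x))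
    (hloc : ∀ x : M, ∃ φ : Module.End R M, Module.Finite k (LinearMap.range φ) ∧ φ x = x)
    (hext : ∀ Q : Submodule R M, Q.IsIndecomposableSummand k →
      ∀ (x : M) (A : Submodule R M) (hA : A ≤ R ∙ x) (f : A →ₗ[R] Q),
      ∃ g : (R ∙ x) →ₗ[R] Q, ∀ a : A, g ⟨a, hA a.2⟩ = f a) :
    ∃ S : Set (Submodule R M), (∀ Q ∈ S, Q.IsIndecomposableSummand k) ∧
      iSupIndep (fun Q : S => (Q : Submodule R M)) ∧ ⨆ Q : S, (Q : Submodule R M) = ⊤ := by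
  classical
  obtain ⟨S, ⟨hSP, hS⟩, hmax⟩ := zorn_subset
    {S : Set (Submodule R M) | (∀ Q ∈ S, Q.IsIndecomposableSummand k) ∧ sSupIndep S}
    fun c hc hch => ⟨⋃₀ c, ⟨fun Q ⟨T, hT, hQ⟩ => (hc hT).1 Q hQ,
      iSupIndep_sUnion_of_directed hch.directedOn fun T hT => (hc hT).2⟩,
      fun T hT => Set.subset_sUnion_of_mem hT⟩
  refine ⟨S, hSP, (sSupIndep_iff S).1 hS, ?_⟩
  let i : (⨁ Q : S, (Q : Submodule R M)) →ₗ[R] M :=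
    DirectSum.coeLinearMap fun Q : S => (Q : Submodule R M)
  have hi : Function.Injective i := ((sSupIndep_iff S).1 hS).dfinsupp_lsum_injective
  have hrange : LinearMap.range i = sSup S := by
    rw [sSup_eq_iSup']
    exact DirectSum.range_coeLinearMap
  -- `F` is a retraction of `M` onto the direct sum, so `ker F` is a complement to the sum of `S`.
  obtain ⟨F, hF⟩ := exists_extend_of_cyclic (M := M)
    (fun x A hA f => by
      have := hcyc x
      have : Module.Finite k A := Submodule.finite_of_le_of_tower hA
      have : Module.Finite R A := Module.Finite.of_restrictScalars_finite k R A
      exact exists_extend_directSum_of_fg A (R ∙ x) hA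
        (fun (Q : S) f => hext Q (hSP Q Q.2) x A hA f) f)
    (LinearMap.range i) (LinearEquiv.ofInjective i hi).symm.toLinearMap
  have hF' : ∀ z, F (i z) = z := fun z => by
    have := hF (LinearEquiv.ofInjective i hi z)
    simpa using this
  rw [← sSup_eq_iSup']
  by_contra hne
  have hC : LinearMap.ker F ≠ ⊥ := fun h => hne <| by
    rw [← hrange, eq_top_iff]
    intro x _
    refine ⟨F x, ?_⟩
    have : F (i (F x)) = F x := hF' _
    exact (LinearMap.ker_eq_bot.1 h) this
  obtain ⟨x, hx, hx0⟩ := Submodule.exists_mem_ne_zero_of_ne_bot hC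
  obtain ⟨φ, hφ, hφx⟩ := hloc x
  let π : Module.End R M := LinearMap.id - i ∘ₗ F
  have hπ : ∀ y, π y = y - i (F y) := fun y => rfl
  -- Since `π` projects onto `ker F`, the finite-rank map `π * φ` has range in `ker F` and still
  -- fixes `x`.
  obtain ⟨e, he, hef, heC, hex⟩ := exists_isIdempotentElem_of_finite_range (k := k)
    (LinearMap.ker F) x (π * φ)
    (by
      have : Module.Finite k ((LinearMap.range φ).map π) :=
        Module.Finite.of_surjective ((π.submoduleMap (LinearMap.range φ)).restrictScalars k)
          (LinearMap.submoduleMap_surjective π _)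
      rwa [← LinearMap.range_comp] at this)
    (by
      rintro _ ⟨y, rfl⟩
      rw [LinearMap.mem_ker, Module.End.mul_apply, hπ, map_sub, hF', sub_self])
    (by rw [Module.End.mul_apply, hφx, hπ, LinearMap.mem_ker.1 hx, map_zero, sub_zero])
  have he0 : e ≠ 0 := by
    rintro rfl
    exact hx0 hex.symm
  obtain ⟨q, hq, hq0, hqf, hqC, hqi⟩ := exists_isIdempotentElem_indecomposable
    (LinearMap.ker F) e he he0 hef heC
  have hQ : (LinearMap.range q).IsIndecomposableSummand k :=
    ⟨fun h => hq0 (LinearMap.range_eq_bot.1 h), hqf, ⟨q.rangeRestrict, by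
      rintro ⟨_, y, rfl⟩
      exact Subtype.ext (LinearMap.congr_fun hq y)⟩, hqi⟩
  have hdisj : Disjoint (LinearMap.range q) (sSup S) := by
    rw [Submodule.disjoint_def, ← hrange]
    rintro _ hy ⟨z, rfl⟩
    have : F (i z) = 0 := hqC hy
    rw [hF'] at this
    rw [this, map_zero]
  have hmem : LinearMap.range q ∈ S :=
    hmax ⟨by
      rintro P (rfl | hP)
      · exact hQ
      · exact hSP P hP, hS.insert_of_disjoint hdisj⟩ (Set.subset_insert _ _)
      (Set.mem_insert _ _)
  exact hQ.ne_bot (disjoint_self.1 (hdisj.mono_right (le_sSup hmem)))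

end Decomposition

end ModuleTheory

/-! ### Indecomposability from trivial idempotents -/

section Indecomposable

open Limits

variable {C : Type*} [Category C] [Preadditive C] [HasBinaryBiproducts C]

theorem CategoryTheory.indecomposable_of_forall_idempotent {X : C} (hX : ¬ IsZero X)
    (h : ∀ t : X ⟶ X, t ≫ t = t → t = 0 ∨ t = 𝟙 X) : Indecomposable X := by
  refine ⟨hX, fun Y Z e => ?_⟩
  have key : ∀ t : Y ⊞ Z ⟶ Y ⊞ Z, t ≫ t = t → t = 0 ∨ t = 𝟙 _ := fun t ht => by
    refine (h (e.hom ≫ t ≫ e.inv) (by simp [reassoc_of% ht])).imp (fun h0 => ?_) fun h1 => ?_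
    · have : e.inv ≫ (e.hom ≫ t ≫ e.inv) ≫ e.hom = 0 := by rw [h0]; simp
      simpa using this
    · have : e.inv ≫ (e.hom ≫ t ≫ e.inv) ≫ e.hom = 𝟙 _ := by rw [h1]; simp
      simpa using this
  refine (key (biprod.fst ≫ biprod.inl) (by simp)).imp (fun h0 => ?_) fun h1 => ?_
  · rw [IsZero.iff_id_eq_zero]
    have : biprod.inl ≫ (biprod.fst ≫ biprod.inl : Y ⊞ Z ⟶ Y ⊞ Z) ≫ biprod.fst = (0 : Y ⟶ Y) := by
      rw [h0]; simp
    simpa using this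
  · rw [IsZero.iff_id_eq_zero]
    have : biprod.inr ≫ (biprod.fst ≫ biprod.inl : Y ⊞ Z ⟶ Y ⊞ Z) ≫ biprod.snd = 𝟙 Z := by
      rw [h1]; simp
    simpa using this.symm

end Indecomposable

/-! ### Submodules over the group algebra and finiteness of smooth representations -/

namespace Representation

section Submodule

variable {k : Type u} {G : Type v} [Field k] [Group G] {V : Type w} [AddCommGroup V] [Module k V]
  {ρ : Representation k G V}

/-- The representation on a `k[G]`-submodule. -/
noncomputable def ofSubmodule (Q : Submodule (MonoidAlgebra k G) ρ.asModule) :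
    Representation k G Q :=
  ofModule' Q

theorem ofSubmodule_apply (Q : Submodule (MonoidAlgebra k G) ρ.asModule) (g : G) (x : Q) :
    ofSubmodule Q g x = MonoidAlgebra.single g (1 : k) • x := by
  simp [ofSubmodule, ofModule', MonoidAlgebra.lift_symm_apply]

theorem coe_ofSubmodule_apply (Q : Submodule (MonoidAlgebra k G) ρ.asModule) (g : G) (x : Q) :
    ((ofSubmodule Q g x : Q) : ρ.asModule) = ρ g (x : ρ.asModule) := by
  rw [ofSubmodule_apply, Submodule.coe_smul, single_smul, one_smul]
  rfl

/-- The inclusion of a submodule as an equivariant map. -/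
noncomputable def ofSubmoduleSubtype (Q : Submodule (MonoidAlgebra k G) ρ.asModule) :
    (ofSubmodule Q).IntertwiningMap ρ where
  toLinearMap := (Q.subtype.restrictScalars k : Q →ₗ[k] ρ.asModule)
  isIntertwining' g := LinearMap.ext fun x => coe_ofSubmodule_apply Q g x

/-- The `k[G]`-linear map between submodules given by an equivariant map. -/
noncomputable def IntertwiningMap.toSubmoduleHom
    {Q Q' : Submodule (MonoidAlgebra k G) ρ.asModule}
    (f : (ofSubmodule Q).IntertwiningMap (ofSubmodule Q')) : Q →ₗ[MonoidAlgebra k G] Q' :=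
  MonoidAlgebra.equivariantOfLinearOfComm f.toLinearMap fun g x => by
    have := f.isIntertwining _ _ g x
    rwa [ofSubmodule_apply, ofSubmodule_apply] at this

theorem exists_comp_mk_eq {E : Type*} [AddCommGroup E] [Module k E] (τ : Representation k G E)
    (N : Subgroup G) [N.Normal] (h : ∀ g ∈ N, ∀ x, τ g x = x) :
    ∃ σ : Representation k (G ⧸ N) E, σ.comp (QuotientGroup.mk' N) = τ :=
  ⟨QuotientGroup.lift N τ fun g hg => LinearMap.ext (h g hg), MonoidHom.ext fun _ => rfl⟩

open DirectSum in
/-- The equivariant isomorphism attached to an internal direct sum decomposition. -/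
theorem nonempty_equiv_directSum {ι : Type*}
    (P : ι → Submodule (MonoidAlgebra k G) ρ.asModule) (hP : iSupIndep P) (hP' : ⨆ i, P i = ⊤)
    (τ : ∀ i, Representation k G (P i)) (hτ : ∀ i, τ i = Representation.ofSubmodule (P i)) :
    Nonempty (ρ.Equiv (Representation.directSum τ)) := by
  classical
  let j : (⨁ i, P i) →ₗ[k] V :=
    DirectSum.toModule k ι V fun i => (ofSubmoduleSubtype (P i)).toLinearMap
  have hj : ∀ x, j x = DirectSum.coeLinearMap P x := fun x => by
    induction x using DirectSum.induction_on with
    | zero => rw [map_zero, map_zero]; rfl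
    | of i x =>
      rw [DirectSum.coeLinearMap_of]
      exact DirectSum.toModule_lof (M := fun i => P i) k i x
    | add a b ha hb => rw [map_add, map_add, ha, hb]; rfl
  have hbij : Function.Bijective j := by
    convert! DirectSum.isInternal_submodule_of_iSupIndep_of_iSup_eq_top hP hP'
  refine ⟨(Representation.Equiv.mk (LinearEquiv.ofBijective j hbij) fun g => ?_ :
    (Representation.directSum τ).Equiv ρ).symm⟩
  refine DirectSum.linearMap_ext k fun i => LinearMap.ext fun x => ?_
  have : ((τ i g x : P i) : ρ.asModule) = ρ g (x : ρ.asModule) := by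
    rw [hτ, coe_ofSubmodule_apply]
  simpa [j] using! this

end Submodule

section Smooth

variable {k : Type u} {G : Type v} [Field k] [Group G] [TopologicalSpace G]
  {V : Type w} [AddCommGroup V] [Module k V] {ρ : Representation k G V}

theorem IsSmooth.ofSubmodule (h : ρ.IsSmooth) (Q : Submodule (MonoidAlgebra k G) ρ.asModule) :
    (ofSubmodule Q).IsSmooth := fun x => by
  obtain ⟨U, hU⟩ := h (x : ρ.asModule)
  exact ⟨U, fun g hg => Subtype.ext ((coe_ofSubmodule_apply Q g x).trans (hU g hg))⟩

theorem IsSmooth.exists_forall_fixed [IsTopologicalGroup G] (h : ρ.IsSmooth) [Module.Finite k V] :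
    ∃ U : OpenNormalSubgroup G, ∀ g ∈ U, ∀ x, ρ g x = x := by
  obtain ⟨s, hs⟩ := Module.Finite.fg_top (R := k) (M := V)
  have : ∀ t : Finset V, ∃ U : OpenNormalSubgroup G, ∀ g ∈ U, ∀ x ∈ t, ρ g x = x := by
    classical
    intro t
    induction t using Finset.induction with
    | empty => exact ⟨{ toSubgroup := ⊤, isOpen' := isOpen_univ }, by simp⟩
    | insert a t _ ih =>
      obtain ⟨U, hU⟩ := ih
      obtain ⟨W, hW⟩ := h a
      refine ⟨U ⊓ W, fun g hg x hx => ?_⟩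
      obtain rfl | hx := Finset.mem_insert.1 hx
      · exact hW g hg.2
      · exact hU g hg.1 x hx
  obtain ⟨U, hU⟩ := this s
  refine ⟨U, fun g hg x => ?_⟩
  have : ρ g = LinearMap.id := LinearMap.ext_on hs fun x hx => hU g hg x hx
  rw [this, LinearMap.id_apply]

/-- The stabiliser of `x` contains an open subgroup, of finite index by compactness, so the orbit is
finite and spans the submodule over `k`. -/
theorem IsSmooth.finite_span_singleton [IsTopologicalGroup G] [CompactSpace G] (h : ρ.IsSmooth)
    (x : ρ.asModule) : Module.Finite k (Submodule.span (MonoidAlgebra k G) {x}) := by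
  obtain ⟨U, hU⟩ := h x
  let F : G ⧸ U.toSubgroup → V := fun c => ρ c.out x
  have hF : ∀ g : G, ρ g x = F g := fun g => by
    obtain ⟨n, hn⟩ := QuotientGroup.mk_out_eq_mul U.toSubgroup g
    change _ = ρ (Quotient.out (g : G ⧸ U.toSubgroup)) x
    rw [hn, map_mul]
    exact congrArg (ρ g) (hU _ n.2).symm
  let T : Submodule k ρ.asModule := Submodule.span k (Set.range F)
  have : Module.Finite k T := Module.Finite.span_of_finite k (Set.finite_range F)
  have hle : (Submodule.span (MonoidAlgebra k G) {x}).restrictScalars k ≤ T := by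
    intro y hy
    obtain ⟨r, rfl⟩ := Submodule.mem_span_singleton.1 hy
    induction r using MonoidAlgebra.induction_on with
    | of g =>
      rw [MonoidAlgebra.of_apply, single_smul, one_smul]
      exact Submodule.subset_span ⟨g, (hF g).symm⟩
    | add a b ha hb =>
      rw [add_smul]
      exact T.add_mem (ha (Submodule.smul_mem _ _ (Submodule.mem_span_singleton_self x)))
        (hb (Submodule.smul_mem _ _ (Submodule.mem_span_singleton_self x)))
    | smul c a ha =>
      rw [smul_assoc]
      exact T.smul_mem c (ha (Submodule.smul_mem _ _ (Submodule.mem_span_singleton_self x)))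
  exact Submodule.finiteDimensional_of_le hle

theorem isSmooth_directSum [IsTopologicalGroup G] {ι : Type*} {E : ι → Type*}
    [∀ i, AddCommGroup (E i)] [∀ i, Module k (E i)] {τ : ∀ i, Representation k G (E i)}
    (h : ∀ i, (τ i).IsSmooth) : (Representation.directSum τ).IsSmooth := by
  classical
  intro z
  induction z using DirectSum.induction_on with
  | zero => exact ⟨{ toSubgroup := ⊤, isOpen' := isOpen_univ }, by simp⟩
  | of i z =>
    obtain ⟨U, hU⟩ := h i z
    refine ⟨U, fun g hg => ?_⟩
    have := hU g hg
    change Representation.directSum τ g (DirectSum.lof k ι E i z) = DirectSum.lof k ι E i z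
    simp [this]
  | add a b ha hb =>
    obtain ⟨U, hU⟩ := ha
    obtain ⟨W, hW⟩ := hb
    exact ⟨U ⊓ W, fun g hg => by rw [map_add, hU g hg.1, hW g hg.2]⟩

/-- If smooth representations jointly cover a smooth projective one, then every vector is recovered
from finitely many of them. -/
theorem IsSmoothProjective.exists_sum_eq [IsTopologicalGroup G] (h : ρ.IsSmoothProjective)
    {ι : Type w} {E : ι → Type w} [∀ i, AddCommGroup (E i)] [∀ i, Module k (E i)]
    (τ : ∀ i, Representation k G (E i)) (hτ : ∀ i, (τ i).IsSmooth)
    (j : ∀ i, (τ i).IntertwiningMap ρ) (hj : ∀ x, ∃ i z, j i z = x) (x : V) :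
    ∃ (Y : Finset ι) (s : ∀ i, ρ.IntertwiningMap (τ i)), ∑ i ∈ Y, j i (s i x) = x := by
  classical
  let q : (Representation.directSum τ).IntertwiningMap ρ :=
    ⟨DirectSum.toModule k ι V fun i => (j i).toLinearMap, fun g => by
      refine DirectSum.linearMap_ext k fun i => LinearMap.ext fun z => ?_
      have := (j i).isIntertwining _ _ g z
      simpa using this⟩
  have hqlof : ∀ i (z : E i), q (DirectSum.lof k ι E i z) = j i z :=
    fun i z => DirectSum.toModule_lof k i z
  obtain ⟨s, hs⟩ := h _ _ (Representation.directSum τ) ρ (isSmooth_directSum hτ) q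
    (fun y => by
      obtain ⟨i, z, rfl⟩ := hj y
      exact ⟨_, hqlof i z⟩) (.id ρ)
  refine ⟨DFinsupp.support (s x), fun i =>
    IntertwiningMap.comp ⟨DirectSum.component k ι E i, fun g => LinearMap.ext fun z => rfl⟩ s, ?_⟩
  conv_rhs => rw [← show q (s x) = x from hs x, ← DirectSum.sum_support_of (s x), map_sum]
  exact Finset.sum_congr rfl fun i _ => (hqlof i (s x i)).symm

/-- Every vector of a smooth projective representation is fixed by an endomorphism of finite
rank. -/
theorem IsSmoothProjective.exists_finite_range [IsTopologicalGroup G] [CompactSpace G]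
    (h : ρ.IsSmoothProjective) (hρ : ρ.IsSmooth) (x : ρ.asModule) :
    ∃ φ : Module.End (MonoidAlgebra k G) ρ.asModule,
      Module.Finite k (LinearMap.range φ) ∧ φ x = x := by
  -- Every vector lies in its own cyclic submodule, so these submodules, indexed by `V`, jointly
  -- cover the representation.
  let P : V → Submodule (MonoidAlgebra k G) ρ.asModule := fun y =>
    Submodule.span (MonoidAlgebra k G) {(y : ρ.asModule)}
  obtain ⟨Y, s, hs⟩ := h.exists_sum_eq (fun y => Representation.ofSubmodule (P y))
    (fun y => hρ.ofSubmodule (P y)) (fun y => ofSubmoduleSubtype (P y))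
    (fun y => ⟨y, ⟨y, Submodule.mem_span_singleton_self _⟩, rfl⟩) x
  let φ : ρ.IntertwiningMap ρ := ∑ y ∈ Y, (ofSubmoduleSubtype (P y)).comp (s y)
  have hφ : ∀ z : V, φ z = ∑ y ∈ Y, ofSubmoduleSubtype (P y) (s y z) := fun z => by
    rw [IntertwiningMap.sum_apply]
    rfl
  refine ⟨IntertwiningMap.equivLinearMapAsModule ρ ρ φ, ?_, (hφ x).trans hs⟩
  have : ∀ y, Module.Finite k (P y) := fun y => hρ.finite_span_singleton y
  -- `φ` factors through a finite product of finite-dimensional submodules, which bounds its rank.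
  let L : (∀ y : Y, P y) →ₗ[k] ρ.asModule := ρ.asModuleEquiv.symm.toLinearMap ∘ₗ
    ∑ y : Y, (ofSubmoduleSubtype (P y)).toLinearMap ∘ₗ LinearMap.proj y
  have hL : ∀ z : V, L (fun y => s y z) = ρ.asModuleEquiv.symm (φ z) := fun z => by
    rw [hφ, ← Finset.sum_coe_sort, LinearMap.comp_apply, LinearMap.sum_apply]
    rfl
  have hle : (LinearMap.range (IntertwiningMap.equivLinearMapAsModule ρ ρ φ)).restrictScalars k ≤
      LinearMap.range L := by
    rintro _ ⟨z, rfl⟩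
    exact ⟨_, hL z⟩
  have : Module.Finite k (LinearMap.range L) := Module.Finite.range L
  exact Submodule.finiteDimensional_of_le hle

end Smooth

end Representation

/-! ### Decomposition of projective discrete modules -/

namespace Representation

variable {k : Type u} {G : Type v} [Field k] [Group G] [TopologicalSpace G]
  {V : Type (max u v w)} [AddCommGroup V] [Module k V] {ρ : Representation k G V}

theorem IsSmoothProjective.ofSubmodule (h : ρ.IsSmoothProjective)
    {Q : Submodule (MonoidAlgebra k G) ρ.asModule}
    (hQ : ∃ π : ρ.asModule →ₗ[MonoidAlgebra k G] Q, ∀ x : Q, π x = x) :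
    (ofSubmodule Q).IsSmoothProjective := by
  obtain ⟨π, hπ⟩ := hQ
  refine h.of_retract (ofSubmoduleSubtype Q) ⟨(π.restrictScalars k : ρ.asModule →ₗ[k] Q),
    fun g => LinearMap.ext fun x => ?_⟩ hπ
  change π (ρ g x) = Representation.ofSubmodule Q g (π x)
  let y : ρ.asModule := x
  have hx : MonoidAlgebra.single g (1 : k) • y = ρ g x := by
    rw [single_smul, one_smul]
    rfl
  rw [ofSubmodule_apply]
  exact (congrArg π hx).symm.trans (π.map_smul (MonoidAlgebra.single g (1 : k)) y)

variable [IsTopologicalGroup G] [CompactSpace G]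

/-- `Q` and `B` are finite-dimensional, so both are representations of one finite quotient of `G`.
Over it `Q` has trace one, hence is injective. -/
theorem IsSmoothProjective.exists_extension (h : ρ.IsSmoothProjective) (hρ : ρ.IsSmooth)
    {Q : Submodule (MonoidAlgebra k G) ρ.asModule} (hQ : Q.IsIndecomposableSummand k)
    (B A : Submodule (MonoidAlgebra k G) ρ.asModule) [Module.Finite k B] (hA : A ≤ B)
    (f : A →ₗ[MonoidAlgebra k G] Q) :
    ∃ g : B →ₗ[MonoidAlgebra k G] Q, ∀ a : A, g ⟨a, hA a.2⟩ = f a := by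
  have := hQ.finite
  obtain ⟨U, hU⟩ := (hρ.ofSubmodule Q).exists_forall_fixed
  obtain ⟨W, hW⟩ := (hρ.ofSubmodule B).exists_forall_fixed
  obtain ⟨σ, hσ⟩ := exists_comp_mk_eq (Representation.ofSubmodule Q) (U ⊓ W).toSubgroup
    fun g hg => hU g hg.1
  obtain ⟨β, hβ⟩ := exists_comp_mk_eq (Representation.ofSubmodule B) (U ⊓ W).toSubgroup
    fun g hg => hW g hg.2
  have hσ' : ∀ (g : G) x, σ g x = Representation.ofSubmodule Q g x := fun g x => by rw [← hσ]; rfl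
  have hβ' : ∀ (g : G) x, β g x = Representation.ofSubmodule B g x := fun g x => by rw [← hβ]; rfl
  have : Fintype (G ⧸ (U ⊓ W).toSubgroup) := Fintype.ofFinite _
  have ht : σ.HasTraceOne := IsSmoothProjective.hasTraceOne.{w} (U ⊓ W)
    (by rw [hσ]; exact h.ofSubmodule hQ.exists_projection)
  let A' : Submodule k B := (A.comap B.subtype).restrictScalars k
  have hA' : ∀ g, ∀ x ∈ A', β g x ∈ A' := by
    intro g x hx
    obtain ⟨g, rfl⟩ := QuotientGroup.mk_surjective g
    rw [hβ', ofSubmodule_apply]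
    exact A.smul_mem _ hx
  let f' : A' →ₗ[k] Q := (f.restrictScalars k) ∘ₗ
    ((B.subtype.restrictScalars k) ∘ₗ A'.subtype).codRestrict (A.restrictScalars k) fun x => x.2
  have hf' : ∀ x : A', f' x = f ⟨x, x.2⟩ := fun x => rfl
  obtain ⟨F, hF⟩ := ht.exists_extension β A' hA' f' (by
    intro g x
    obtain ⟨g, rfl⟩ := QuotientGroup.mk_surjective g
    rw [hσ', ofSubmodule_apply, hf', hf', ← map_smul]
    congr 1
    refine Subtype.ext ?_
    change ((β g x : B) : ρ.asModule) = _
    rw [hβ', ofSubmodule_apply]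
    rfl)
  refine ⟨IntertwiningMap.toSubmoduleHom ⟨F.toLinearMap, fun g => LinearMap.ext fun x => ?_⟩,
    fun a => hF ⟨⟨a, hA a.2⟩, a.2⟩⟩
  have := F.isIntertwining _ _ (g : G ⧸ (U ⊓ W).toSubgroup) x
  rw [hσ', hβ'] at this
  exact this

theorem IsSmoothProjective.exists_decomposition (h : ρ.IsSmoothProjective) (hρ : ρ.IsSmooth) :
    ∃ S : Set (Submodule (MonoidAlgebra k G) ρ.asModule),
      (∀ Q ∈ S, Q.IsIndecomposableSummand k) ∧
      iSupIndep (fun Q : S => (Q : Submodule (MonoidAlgebra k G) ρ.asModule)) ∧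
      ⨆ Q : S, (Q : Submodule (MonoidAlgebra k G) ρ.asModule) = ⊤ :=
  exists_iSupIndep_isIndecomposableSummand k (fun x => hρ.finite_span_singleton x)
    (fun x => h.exists_finite_range hρ x) fun Q hQ x A hA f => by
      have := hρ.finite_span_singleton x
      exact h.exists_extension hρ hQ _ A hA f

/-- An indecomposable summand comes from an indecomposable projective module over a finite
quotient. -/
theorem IsSmoothProjective.exists_rep [TotallyDisconnectedSpace G] (h : ρ.IsSmoothProjective)
    (hρ : ρ.IsSmooth) {Q : Submodule (MonoidAlgebra k G) ρ.asModule}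
    (hQ : Q.IsIndecomposableSummand k) :
    ∃ (H : OpenNormalSubgroup G) (σ : Representation k (G ⧸ H.toSubgroup) Q),
      σ.comp (QuotientGroup.mk' H.toSubgroup) = Representation.ofSubmodule Q ∧
      (∀ U : OpenNormalSubgroup H, (Nat.card (H ⧸ U.toSubgroup) : k) ≠ 0) ∧
      Indecomposable (Rep.of σ) ∧ Projective (Rep.of σ) := by
  have := hQ.finite
  obtain ⟨H, hH⟩ := (hρ.ofSubmodule Q).exists_forall_fixed
  obtain ⟨σ, hσ⟩ := exists_comp_mk_eq (Representation.ofSubmodule Q) H.toSubgroup hH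
  have hp : IsSmoothProjective (σ.comp (QuotientGroup.mk' H.toSubgroup)) := by
    rw [hσ]
    exact h.ofSubmodule hQ.exists_projection
  have : Fintype (G ⧸ H.toSubgroup) := Fintype.ofFinite _
  have : Nontrivial Q := Submodule.nontrivial_iff_ne_bot.2 hQ.ne_bot
  refine ⟨H, σ, hσ, IsSmoothProjective.card_ne_zero.{w} H hp, ?_,
    Rep.projective_of_hasTraceOne (IsSmoothProjective.hasTraceOne.{w} H hp)⟩
  refine indecomposable_of_forall_idempotent (fun h0 => ?_) fun t ht => ?_
  · obtain ⟨x, hx⟩ := exists_ne (0 : Q)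
    have := (Limits.IsZero.iff_id_eq_zero _).1 h0
    exact hx (congrArg (fun t : Rep.of σ ⟶ Rep.of σ => t.hom x) this)
  · let t' : Module.End (MonoidAlgebra k G) Q := IntertwiningMap.toSubmoduleHom
      ⟨t.hom.toLinearMap, fun g => by rw [← hσ]; exact t.hom.isIntertwining' g⟩
    have ht' : IsIdempotentElem t' := LinearMap.ext fun x =>
      congrArg (fun t : Rep.of σ ⟶ Rep.of σ => t.hom x) ht
    refine (hQ.idempotent t' ht').imp (fun h0 => ?_) fun h1 => ?_
    · ext x
      exact congrArg Subtype.val (LinearMap.congr_fun h0 x)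
    · ext x
      exact congrArg Subtype.val (LinearMap.congr_fun h1 x)

end Representation

/-! ### The main theorem -/

theorem corollary3p3 {k : Type u} {G : Type v} [Field k] (p : ℕ) [CharP k p]
    [Group G] [TopologicalSpace G] [IsTopologicalGroup G] [CompactSpace G]
    [TotallyDisconnectedSpace G] :
    (∀ H : OpenNormalSubgroup G, ¬ SupernaturalNumber.PrimeDvd p (profiniteOrder H) →
      ∀ X : Rep.{max u v w} k (G ⧸ H.toSubgroup), Projective X ↔ Projective (inflation H X)) ∧
    (∀ M : DiscreteRep.{max u v w} k G, Projective M ↔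
      ∃ (ι : Type (max u v w)) (H : ι → OpenNormalSubgroup G)
        (X : ∀ i, Rep.{max u v w} k (G ⧸ (H i).toSubgroup)),
        (∀ i, ¬ SupernaturalNumber.PrimeDvd p (profiniteOrder (H i)) ∧
          FiniteDimensional k (X i).V ∧ Indecomposable (X i) ∧ Projective (X i)) ∧
        Nonempty (M.obj ≅
          Rep.of (Representation.directSum fun i => (inflation (H i) (X i)).obj.ρ))) := by
  have hcard : ∀ H : OpenNormalSubgroup G, ¬ SupernaturalNumber.PrimeDvd p (profiniteOrder H) ↔
      ∀ U : OpenNormalSubgroup H, (Nat.card (H ⧸ U.toSubgroup) : k) ≠ 0 := fun H => by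
    rw [primeDvd_profiniteOrder_iff k p, not_exists]
  refine ⟨fun H hH X => projective_iff_projective_inflation.{w} H ((hcard H).1 hH) X,
    fun M => ⟨fun hM => ?_, ?_⟩⟩
  · have hs := M.property.isSmooth
    have hp := (DiscreteRep.projective_iff M).1 hM
    obtain ⟨S, hS, hind, htop⟩ := Representation.IsSmoothProjective.exists_decomposition.{w} hp hs
    choose H σ hσ hH hX hX' using fun Q : S =>
      Representation.IsSmoothProjective.exists_rep.{w} hp hs (hS Q Q.2)
    refine ⟨S, H, fun Q => Rep.of (σ Q),
      fun Q => ⟨(hcard _).2 (hH Q), (hS Q Q.2).finite, hX Q, hX' Q⟩, ?_⟩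
    obtain ⟨e⟩ := Representation.nonempty_equiv_directSum (ρ := M.obj.ρ)
      (fun Q : S => (Q : Submodule (MonoidAlgebra k G) M.obj.ρ.asModule)) hind htop
      (fun Q => (inflation (H Q) (Rep.of (σ Q))).obj.ρ) hσ
    exact ⟨Rep.mkIso e⟩
  · rintro ⟨ι, H, X, hX, ⟨e⟩⟩
    rw [DiscreteRep.projective_iff]
    have hd : (Representation.directSum fun i =>
        (inflation (H i) (X i)).obj.ρ).IsSmoothProjective := by
      refine Representation.IsSmoothProjective.directSum fun i => ?_
      rw [← DiscreteRep.projective_iff]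
      exact (projective_iff_projective_inflation.{w} (H i) ((hcard _).1 (hX i).1) (X i)).1
        (hX i).2.2.2
    exact hd.of_retract e.hom.hom e.inv.hom fun x => Rep.inv_hom_apply _ _ e x
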